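/- Let $\diamondsuit$ be a finite cellular decomposition, by quadrilaterals, of a compact connected oriented surface of genus $g$, with bipartite vertex set. The diagonals of the quadrilaterals form two dual cellular decompositions $\Gamma$ and $\Gamma^*$ (one on each colour class of vertices); let $\Lambda=\Gamma\sqcup\Gamma^*$. If $(x,y,x',y')$ is a quadrilateral listed counterclockwise and $e=(x,x')$ is one of its diagonals, put $e^*=(y,y')$. Let $\rho>0$ be a function on the unoriented edges of $\Lambda$ with $\rho(e^*)=1/\rho(e)$ (a discrete conformal structure). One-forms on $\Lambda$ are complex functions of the oriented edges of $\Lambda$ that change sign under reversal of the orientation; $d$ is the coboundary, the Hodge star is $\int_e *\alpha=-\rho(e^*)\int_{e^*}\alpha$ on one-forms and identifies functions with two-forms by $\iint_{v^*}*f=f(v)$ and $(*\omega)(v)=\iint_{v^*}\omega$, where $v^*$ is the face of $\Lambda$ dual to the vertex $v$. A one-form is harmonic if it lies in the kernel of $\Delta=-d*d*-*d*d$, and holomorphic if $d\alpha=0$ and $*\alpha=-i\alpha$. The scalar product is $$(\alpha,\beta)=\tfrac12\sum_{e}\rho(e)\int_e\alpha\ \overline{\int_e\beta},$$ where the sum is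 over all oriented edges $e$ of $\Lambda$, so that every unoriented edge contributes $\rho(e)\int_e\alpha\,\overline{\int_e\beta}$ exactly once. The intersection number $A\cdot B$ of two chains on $\Lambda$ is bilinear, with $e\cdot e^*=1$, $e^*\cdot e=-1$ and $e\cdot e'=0$ for edges $e'\neq\pm e^*$. For an integral cycle $c$ on $\Lambda$, $\eta_c$ denotes the harmonic one-form with $\oint_A\eta_c=A\cdot c$ for every cycle $A$ on $\Lambda$. Let $\aleph_1,\dots,\aleph_{2g}$ be integral cycles on $\diamondsuit$ that form a basis of $H_1(\diamondsuit,\mathbb Z)$ and have the intersection matrix $\begin{pmatrix}0&I\\-I&0\end{pmatrix}$ (a canonical dissection), and let $\aleph^\Gamma_k$, $\aleph^{\Gamma^*}_k$ be cycles on $\Gamma$ and on $\Gamma^*$ homologous to $\aleph_k$ on the surface; the intersection number of $\aleph_k$ and $\aleph_l$ is $\aleph^\Gamma_k\cdot\aleph^{\Gamma^*}_l$. For $1\le k\le g$ put $$\aleph^\Lambda_k=\aleph^\Gamma_k,\quad \aleph^\Lambda_{k+g}=\aleph^{\Gamma^*}_k,\quad \aleph^\Lambda_{k+2g}=\aleph^{\Gamma^*}_{k+g},\quad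 \aleph^\Lambda_{k+3g}=\aleph^{\Gamma}_{k+g},$$ and for $1\le k\le 2g$ put $\alpha_k=\eta_{\aleph^\Lambda_{k+2g}}$ and $\alpha_{k+2g}=-\eta_{\aleph^\Lambda_k}$. Write the matrix of inner products in $2g\times 2g$ blocks, $$\big((\alpha_k,\alpha_l)\big)_{1\le k,l\le 4g}=\begin{pmatrix}A&D\\B&C\end{pmatrix}.$$ Then the forms $\eta_{\aleph^\Lambda_k}$ exist and are unique, $(\alpha_k)_{1\le k\le 4g}$ is a basis of the space of harmonic one-forms, and $C$ is invertible. With $\Pi=C^{-1}(i-B)$, the forms $$\zeta_k=(i-*)\sum_{l=1}^{2g}C^{-1}_{k,l}\,\alpha_{l+2g},\qquad 1\le k\le 2g,$$ are a basis of the space of holomorphic one-forms, and $\Pi$ is their period matrix: $$\oint_{\aleph^\Lambda_k}\zeta_l=\delta_{k,l}\ \text{ for } 1\le k\le 2g,\qquad \oint_{\aleph^\Lambda_k}\zeta_l=\Pi_{k-2g,\,l}\ \text{ for } 2g<k\le 4g.$$ The $2g\times2g$ matrix $\Pi$ is symmetric, and its imaginary part is positive definite. -/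

import Mathlib

noncomputable section

/-- A compact connected oriented surface cut into quadrilaterals, with a bipartite vertex set and a
discrete conformal structure.

`D` is the (finite) set of oriented edges of the quad-graph `◇`. An oriented edge `d` is the same
thing as a quadrilateral with a marked corner: `d` stands for the quadrilateral `(x, y, x', y')`,
listed counterclockwise, that lies to the left of `d = (x, y)`. Hence `d` also labels the oriented
diagonal `(x, x')`, an oriented edge of the double graph `Λ = Γ ⊔ Γ*`.

* `face d = (y, x')` is the next side of the same quadrilateral; as a diagonal, `face d = (y, y')`
  is the dual edge of `(x, x')`, and `face (face d)` is the reversed diagonal `(x', x)`.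
* `flip d = (y, x)` is the reversed side, which belongs to the adjacent quadrilateral.
* `color d` tells whether the origin `x` of `d` is a vertex of `Γ` (`true`) or of `Γ*` (`false`).
* `rho d` is the value of the conformal structure on the diagonal `(x, x')`. -/
structure DiscreteRiemannSurface (D : Type*) where
  face : Equiv.Perm D
  flip : Equiv.Perm D
  color : D → Bool
  rho : D → ℝ
  nonempty : Nonempty D
  face_four : ∀ d, face (face (face (face d))) = d
  face_two_ne : ∀ d, face (face d) ≠ d
  flip_flip : ∀ d, flip (flip d) = d
  flip_ne : ∀ d, flip d ≠ d
  connected : ∀ d d', ∃ π ∈ Subgroup.closure {face, flip}, π d = d'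
  color_face : ∀ d, color (face d) = !color d
  color_flip : ∀ d, color (flip d) = !color d
  rho_pos : ∀ d, 0 < rho d
  rho_face : ∀ d, rho (face d) = (rho d)⁻¹

namespace DiscreteRiemannSurface

variable {D : Type*} (S : DiscreteRiemannSurface D)

/-- Counterclockwise rotation about the origin: `(x, y) ↦ (x, y')`. -/
def rot : Equiv.Perm D := S.flip * S.face⁻¹

/-- Vertices of the quad-graph, which are also the vertices of `Λ`: cycles of the rotation. The
two-cells of `Λ` are the duals `v*` of the vertices `v`, so `Vertex` labels them too. -/
def Vertex : Type _ := Quotient (Equiv.Perm.SameCycle.setoid S.rot)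

/-- The origin `x` of `d`. -/
def src (d : D) : S.Vertex := Quotient.mk _ d

instance [Finite D] : Finite S.Vertex :=
  inferInstanceAs (Finite (Quotient (Equiv.Perm.SameCycle.setoid S.rot)))

instance [Finite D] : Fintype S.Vertex := Fintype.ofFinite _

/-! ### Forms on `Λ` -/

/-- Complex one-cochains on `Λ`: functions of the oriented diagonals, odd under reversal. -/
def OneForm : Submodule ℂ (D → ℂ) where
  carrier := {α | ∀ d, α (S.face (S.face d)) = -α d}
  add_mem' := by
    intro a b ha hb d
    simp only [Pi.add_apply, ha d, hb d]
    ring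
  zero_mem' := by intro d; simp
  smul_mem' := by
    intro c a ha d
    simp only [Pi.smul_apply, ha d, smul_neg]

/-- The coboundary of functions: `∫_{(x, x')} df = f x' - f x`. -/
def d₀ : (S.Vertex → ℂ) →ₗ[ℂ] S.OneForm where
  toFun f := ⟨fun d => f (S.src (S.face (S.face d))) - f (S.src d), by
    intro d
    simp [S.face_four]⟩
  map_add' f g := by
    ext d
    simp only [Pi.add_apply, Submodule.coe_add]
    ring
  map_smul' c f := by
    ext d
    simp only [Pi.smul_apply, smul_eq_mul, RingHom.id_apply, Submodule.coe_smul]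
    ring

open Classical in
/-- The coboundary of one-forms: the value on the two-cell `v*` is the integral along its
counterclockwise boundary, formed by the duals of the diagonals that leave `v`. Two-forms are
functions of the vertex `v`. -/
def d₁ [Fintype D] : S.OneForm →ₗ[ℂ] (S.Vertex → ℂ) where
  toFun α := fun v => ∑ d : D with S.src d = v, α.1 (S.face d)
  map_add' α β := by
    ext v
    simp [Finset.sum_add_distrib]
  map_smul' c α := by
    ext v
    simp [Finset.mul_sum]

/-- The Hodge star on one-forms: `∫_e *α = -ρ(e*) ∫_{e*} α`. -/
def star₁ : S.OneForm →ₗ[ℂ] S.OneForm where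
  toFun α := ⟨fun d => -(S.rho (S.face d) : ℂ) * α.1 (S.face d), by
    intro d
    have h := α.2 (S.face d)
    have hr : S.rho (S.face (S.face (S.face d))) = S.rho (S.face d) := by
      rw [S.rho_face, S.rho_face, inv_inv]
    simp only [hr, h]
    ring⟩
  map_add' α β := by
    ext d
    simp only [Submodule.coe_add, Pi.add_apply]
    ring
  map_smul' c α := by
    ext d
    simp only [Submodule.coe_smul, Pi.smul_apply, smul_eq_mul, RingHom.id_apply]
    ring

/-- The Hodge star from functions to two-forms: the integral of `*f` over `v*` is `f v`. -/
def star₀ : (S.Vertex → ℂ) →ₗ[ℂ] (S.Vertex → ℂ) := LinearMap.id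

/-- The Hodge star from two-forms to functions: `(*ω) v` is the integral of `ω` over `v*`. -/
def star₂ : (S.Vertex → ℂ) →ₗ[ℂ] (S.Vertex → ℂ) := LinearMap.id

/-- The Laplacian `Δ = -d * d * - * d * d` on one-forms. -/
def laplacian [Fintype D] : S.OneForm →ₗ[ℂ] S.OneForm :=
  -(S.d₀ ∘ₗ S.star₂ ∘ₗ S.d₁ ∘ₗ S.star₁) - S.star₁ ∘ₗ S.d₀ ∘ₗ S.star₂ ∘ₗ S.d₁

/-- Harmonic one-forms. -/
def harmonicForms [Fintype D] : Submodule ℂ S.OneForm := LinearMap.ker S.laplacian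

/-- Holomorphic one-forms: `dα = 0` and `*α = -iα`. -/
def holomorphicForms [Fintype D] : Submodule ℂ S.OneForm :=
  LinearMap.ker S.d₁ ⊓ LinearMap.ker (S.star₁ + Complex.I • LinearMap.id)

/-- The scalar product `(α, β) = ½ ∑ ρ(e) ∫_e α ∫_e β̄`, the sum being over all *oriented* edges `e`
of `Λ`; so every edge of `Γ` and every edge of `Γ*` contributes its term once. -/
def scalarProd [Fintype D] (α β : S.OneForm) : ℂ :=
  (1 / 2) * ∑ d : D, (S.rho d : ℂ) * α.1 d * starRingEnd ℂ (β.1 d)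

/-! ### Cycles

A function `c : D → ℤ` is read as the formal sum `∑ c(d) d` of oriented edges, either sides of the
quadrilaterals (chains on `◇`) or diagonals (chains on `Λ`); the relation `ē = -e` is imposed when
classes are taken. -/

/-- The integral of a one-form over a formal sum of oriented diagonals. -/
def integral [Fintype D] (c : D → ℤ) (α : S.OneForm) : ℂ := ∑ d : D, (c d : ℂ) * α.1 d

open Classical in
/-- One-cycles on `◇`. -/
def quadCycles [Fintype D] : Submodule ℤ (D → ℤ) :=
  LinearMap.ker (Fintype.linearCombination ℤ fun d : D =>
    (Pi.single (S.src (S.flip d)) 1 - Pi.single (S.src d) 1 : S.Vertex → ℤ))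

open Classical in
/-- One-cycles on `Λ`. -/
def doubleCycles [Fintype D] : Submodule ℤ (D → ℤ) :=
  LinearMap.ker (Fintype.linearCombination ℤ fun d : D =>
    (Pi.single (S.src (S.face (S.face d))) 1 - Pi.single (S.src d) 1 : S.Vertex → ℤ))

open Classical in
/-- Null-homologous chains on `◇`: spanned by the sums `e + ē` and the boundaries of the
quadrilaterals. -/
def quadBoundaries : Submodule ℤ (D → ℤ) :=
  Submodule.span ℤ
    ((Set.range fun d : D => Pi.single d 1 + Pi.single (S.flip d) 1) ∪
      Set.range fun d : D => Pi.single d 1 + Pi.single (S.face d) 1 +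
        Pi.single (S.face (S.face d)) 1 + Pi.single (S.face (S.face (S.face d))) 1)

/-- The chain `a` on `Λ` is homologous, on the surface, to the chain `c` on `◇`: replacing every
diagonal `(x, x')` of `a` by the path `(x, y) + (y, x')` along its quadrilateral gives `c` up to a
null-homologous chain. -/
def Homologous (a c : D → ℤ) : Prop :=
  (fun d => a d + a (S.face.symm d)) - c ∈ S.quadBoundaries

/-- The intersection number of two chains on `Λ`: it counts algebraically how often `a` contains an
edge dual to an edge of `b`, with `e · e* = 1` and `e* · e = -1`. -/
def inter [Fintype D] (a b : D → ℤ) : ℤ :=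
  ∑ d : D, a d * (b (S.face d) - b (S.face.symm d))

/-- `η` is the harmonic one-form attached to the cycle `c` on `Λ`: its integral along every cycle
is the intersection number of this cycle with `c`. -/
def IsEta [Fintype D] (c : D → ℤ) (η : S.OneForm) : Prop :=
  η ∈ S.harmonicForms ∧ ∀ a ∈ S.doubleCycles, S.integral a η = (S.inter a c : ℂ)

/-- The harmonic one-form `η_c`. -/
def eta [Fintype D] (c : D → ℤ) : S.OneForm := Classical.epsilon (S.IsEta c)

/-- A canonical dissection of `◇`: integral cycles `ℵ₁, …, ℵ_{2g}` on `◇` that form a basis of the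
first homology group and have the standard intersection numbers, together with homologous cycles
on `Γ` and on `Γ*`. The first `g` cycles have the indices `Sum.inl k`, the last `g` the indices
`Sum.inr k`. The intersection number of two cycles on `◇` is that of a cycle on `Γ` homologous to
the first with a cycle on `Γ*` homologous to the second. -/
structure CanonicalDissection [Fintype D] (g : ℕ) where
  cyc : Fin g ⊕ Fin g → D → ℤ
  cyc_mem : ∀ k, cyc k ∈ S.quadCycles
  linearIndependent : LinearIndependent ℤ fun k => S.quadBoundaries.mkQ (cyc k)
  span_eq : Submodule.span ℤ (Set.range fun k => S.quadBoundaries.mkQ (cyc k)) =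
    S.quadCycles.map S.quadBoundaries.mkQ
  primal : Fin g ⊕ Fin g → D → ℤ
  primal_mem : ∀ k, primal k ∈ S.doubleCycles
  primal_support : ∀ k d, S.color d = false → primal k d = 0
  primal_homologous : ∀ k, S.Homologous (primal k) (cyc k)
  dual : Fin g ⊕ Fin g → D → ℤ
  dual_mem : ∀ k, dual k ∈ S.doubleCycles
  dual_support : ∀ k d, S.color d = true → dual k d = 0
  dual_homologous : ∀ k, S.Homologous (dual k) (cyc k)
  inter_eq : ∀ k l, S.inter (primal k) (dual l) =
    (Matrix.fromBlocks 0 1 (-1) 0 : Matrix (Fin g ⊕ Fin g) (Fin g ⊕ Fin g) ℤ) k l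

namespace CanonicalDissection

variable {S} [Fintype D] {g : ℕ} (N : S.CanonicalDissection g)

/-- The `4g` cycles `ℵ^Λ` on `Λ`, in the order `ℵ^Γ_k`, `ℵ^{Γ*}_k`, `ℵ^{Γ*}_{k+g}`, `ℵ^Γ_{k+g}`
(`1 ≤ k ≤ g`). The first `2g` of them have the indices `Sum.inl _`. -/
def cycΛ : (Fin g ⊕ Fin g) ⊕ (Fin g ⊕ Fin g) → D → ℤ :=
  Sum.elim
    (Sum.elim (fun k => N.primal (Sum.inl k)) (fun k => N.dual (Sum.inl k)))
    (Sum.elim (fun k => N.dual (Sum.inr k)) (fun k => N.primal (Sum.inr k)))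

/-- The harmonic forms `α_k = η_{ℵ_{k+2g}}` and `α_{k+2g} = -η_{ℵ_k}`, for `1 ≤ k ≤ 2g`. -/
def α : (Fin g ⊕ Fin g) ⊕ (Fin g ⊕ Fin g) → S.OneForm :=
  Sum.elim (fun k => S.eta (N.cycΛ (Sum.inr k))) (fun k => -S.eta (N.cycΛ (Sum.inl k)))

/-- The matrix of inner products `(α_k, α_l)`; its blocks are `A, D` (first rows) and `B, C`. -/
def gram : Matrix ((Fin g ⊕ Fin g) ⊕ (Fin g ⊕ Fin g)) ((Fin g ⊕ Fin g) ⊕ (Fin g ⊕ Fin g)) ℂ :=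
  Matrix.of fun k l => S.scalarProd (N.α k) (N.α l)

/-- The lower left block of the matrix of inner products. -/
def B : Matrix (Fin g ⊕ Fin g) (Fin g ⊕ Fin g) ℂ := N.gram.toBlocks₂₁

/-- The lower right block of the matrix of inner products. -/
def C : Matrix (Fin g ⊕ Fin g) (Fin g ⊕ Fin g) ℂ := N.gram.toBlocks₂₂

/-- `Π = C⁻¹ (i - B)`. -/
def periodMatrix : Matrix (Fin g ⊕ Fin g) (Fin g ⊕ Fin g) ℂ :=
  N.C⁻¹ * (Complex.I • (1 : Matrix (Fin g ⊕ Fin g) (Fin g ⊕ Fin g) ℂ) - N.B)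

/-- `ζ_k = (i - *) ∑ C⁻¹_{k l} α_{l + 2g}`. -/
def ζ (k : Fin g ⊕ Fin g) : S.OneForm :=
  let β : S.OneForm := ∑ l, N.C⁻¹ k l • N.α (Sum.inr l)
  Complex.I • β - S.star₁ β

end CanonicalDissection

end DiscreteRiemannSurface

end

/-! The proof is Hodge theory on a finite complex. As `*` is an isometry with `** = -1`, and `d` on
functions is minus the adjoint of `d*`, pairing `Δα` with `α` shows that harmonic means closed and
coclosed (`mem_harmonicForms`). Every closed form then has exactly one harmonic representative
modulo exact forms; applied to `A ↦ A · c` this gives `η_c` (`existsUnique_isEta`).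

The topological input is that `4g` periods determine a closed form up to exact ones: on either graph
a closed form comes from a closed cochain on `◇`, which sees only homology classes
(`integral_eq_zero_of_path_mem`). The intersection matrix makes the `α_k` dual to the cycles, hence
a basis.

Inner products with `η_c` are periods of `*μ` (`scalarProd_eta`), so `B` and `C` contain the periods
of `*α_{k+2g}`. They are real, `C` is a Gram matrix of independent forms, and `** = -1` gives `C Bᵀ
= B C`. Hence `Π = i C⁻¹ - C⁻¹ B` is symmetric with imaginary part `C⁻¹`. The `ζ_k` span because a
holomorphic form without periods along the first `2g` cycles is orthogonal to itself
(`eq_zero_of_holomorphic`). -/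

namespace DiscreteRiemannSurface

variable {D : Type*} (S : DiscreteRiemannSurface D)

/-! ### Combinatorics of the quad-graph -/

lemma face_symm_apply (d : D) : S.face.symm d = S.face (S.face (S.face d)) := by
  rw [Equiv.symm_apply_eq, S.face_four]

lemma rho_face_face (d : D) : S.rho (S.face (S.face d)) = S.rho d := by
  rw [S.rho_face, S.rho_face, inv_inv]

lemma rot_face (d : D) : S.rot (S.face d) = S.flip d := by
  simp [rot]

lemma exists_src_eq (v : S.Vertex) : ∃ d, S.src d = v := Quotient.exists_rep v

lemma src_rot (d : D) : S.src (S.rot d) = S.src d := by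
  refine Quotient.sound ?_
  exact ⟨-1, by simp⟩

lemma src_flip (d : D) : S.src (S.flip d) = S.src (S.face d) := by
  rw [← rot_face, src_rot]

lemma color_rot (d : D) : S.color (S.rot d) = S.color d := by
  have h := S.color_face (S.face.symm d)
  rw [Equiv.apply_symm_apply] at h
  simp [rot, S.color_flip, Equiv.Perm.inv_def, h]

-- Used for the colour, which thus depends only on the vertex, and for totals over full turns around
-- a vertex.
variable {S} in
lemma eq_of_src_eq {M : Type*} {F : D → M} (hF : ∀ d, F (S.rot d) = F d) {d e : D}
    (h : S.src d = S.src e) : F d = F e := by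
  have key : ∀ n : ℕ, ∀ x, F ((S.rot ^ n) x) = F x := by
    intro n
    induction n with
    | zero => simp
    | succ n ih => intro x; rw [pow_succ, Equiv.Perm.mul_apply, ih, hF]
  obtain ⟨i, hi⟩ : S.rot.SameCycle d e := Quotient.exact h
  rcases i with n | n
  · rw [← hi]
    exact (key n d).symm
  · rw [← key (n + 1) e, ← hi, zpow_negSucc, Equiv.Perm.inv_def, Equiv.apply_symm_apply]

/-! ### Sums over the vertices and the edges -/

section Sums

variable {S}

lemma OneForm.apply_face_face (α : S.OneForm) (d : D) :
    α.1 (S.face (S.face d)) = -α.1 d := α.2 d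

@[simp] lemma star₁_apply (α : S.OneForm) (d : D) :
    (S.star₁ α).1 d = -(S.rho (S.face d) : ℂ) * α.1 (S.face d) := rfl

@[simp] lemma d₀_apply (f : S.Vertex → ℂ) (d : D) :
    (S.d₀ f).1 d = f (S.src (S.face (S.face d))) - f (S.src d) := rfl

lemma star₁_star₁ (α : S.OneForm) : S.star₁ (S.star₁ α) = -α := by
  ext d
  have h : (S.rho d : ℂ) ≠ 0 := by exact_mod_cast (S.rho_pos d).ne'
  simp [OneForm.apply_face_face, S.rho_face, h]

variable [Fintype D]

open Classical in
lemma d₁_apply (α : S.OneForm) (v : S.Vertex) :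
    S.d₁ α v = ∑ d : D with S.src d = v, α.1 (S.face d) := rfl

variable (S) in
lemma sum_comp_face {M : Type*} [AddCommMonoid M] (F : D → M) :
    ∑ d, F (S.face d) = ∑ d, F d := Equiv.sum_comp S.face F

open Classical in
variable (S) in
lemma sum_vertex_mul (f : S.Vertex → ℂ) (F : D → ℂ) :
    ∑ v, f v * ∑ d : D with S.src d = v, F d = ∑ d, f (S.src d) * F d := by
  rw [← Finset.sum_fiberwise (s := Finset.univ) (g := S.src)]
  refine Finset.sum_congr rfl fun v _ => ?_
  rw [Finset.mul_sum]
  refine Finset.sum_congr rfl fun d hd => ?_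
  rw [(Finset.mem_filter.1 hd).2]

/-! ### The scalar product -/

lemma scalarProd_add_left (α β γ : S.OneForm) :
    S.scalarProd (α + β) γ = S.scalarProd α γ + S.scalarProd β γ := by
  simp only [scalarProd, ← mul_add, ← Finset.sum_add_distrib]
  simp [mul_add, add_mul]

lemma scalarProd_smul_left (c : ℂ) (α β : S.OneForm) :
    S.scalarProd (c • α) β = c * S.scalarProd α β := by
  simp only [scalarProd, Finset.mul_sum]
  refine Finset.sum_congr rfl fun d _ => ?_
  simp only [Submodule.coe_smul, Pi.smul_apply, smul_eq_mul]
  ring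

/-- The scalar product as a linear function of its first argument. -/
noncomputable def scalarProdLeft (β : S.OneForm) : S.OneForm →ₗ[ℂ] ℂ where
  toFun α := S.scalarProd α β
  map_add' α α' := scalarProd_add_left α α' β
  map_smul' c α := scalarProd_smul_left c α β

@[simp] lemma scalarProdLeft_apply (α β : S.OneForm) :
    scalarProdLeft β α = S.scalarProd α β := rfl

lemma conj_scalarProd (α β : S.OneForm) :
    starRingEnd ℂ (S.scalarProd α β) = S.scalarProd β α := by
  simp only [scalarProd, map_mul, map_sum, Complex.conj_ofReal, Complex.conj_conj]
  congr 1
  · simp [Complex.conj_ofNat]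
  · exact Finset.sum_congr rfl fun d _ => by ring

lemma scalarProd_self (α : S.OneForm) :
    S.scalarProd α α = ((1 / 2 * ∑ d, S.rho d * Complex.normSq (α.1 d) : ℝ) : ℂ) := by
  simp only [scalarProd, mul_assoc, Complex.mul_conj]
  push_cast
  ring

lemma eq_zero_of_scalarProd_self {α : S.OneForm} (h : S.scalarProd α α = 0) : α = 0 := by
  rw [scalarProd_self, Complex.ofReal_eq_zero] at h
  have h' : ∑ d, S.rho d * Complex.normSq (α.1 d) = 0 := by linarith
  rw [Finset.sum_eq_zero_iff_of_nonneg fun d _ =>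
    mul_nonneg (S.rho_pos d).le (Complex.normSq_nonneg _)] at h'
  ext d
  simpa [(S.rho_pos d).ne'] using h' d (Finset.mem_univ d)

lemma scalarProd_self_re_pos {α : S.OneForm} (h : α ≠ 0) : 0 < (S.scalarProd α α).re := by
  refine lt_of_le_of_ne ?_ fun h0 => h (eq_zero_of_scalarProd_self ?_)
  · rw [scalarProd_self, Complex.ofReal_re]
    exact mul_nonneg (by norm_num) (Finset.sum_nonneg fun d _ =>
      mul_nonneg (S.rho_pos d).le (Complex.normSq_nonneg _))
  · rw [scalarProd_self, Complex.ofReal_re] at h0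
    rw [scalarProd_self, ← h0, Complex.ofReal_zero]

/-- The shift by `face` exchanges each edge with its dual, and the two factors `ρ(e*)` turn the
weight `ρ(e)` into `ρ(e*)`. -/
lemma scalarProd_star₁_star₁ (α β : S.OneForm) :
    S.scalarProd (S.star₁ α) (S.star₁ β) = S.scalarProd α β := by
  unfold scalarProd
  rw [← S.sum_comp_face fun d => (S.rho d : ℂ) * α.1 d * starRingEnd ℂ (β.1 d)]
  congr 1
  refine Finset.sum_congr rfl fun d _ => ?_
  have h : (S.rho d : ℂ) ≠ 0 := by exact_mod_cast (S.rho_pos d).ne'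
  simp only [star₁_apply, S.rho_face, map_mul, map_neg, Complex.conj_ofReal]
  push_cast
  field_simp

lemma scalarProd_star₁_left (α β : S.OneForm) :
    S.scalarProd (S.star₁ α) β = -S.scalarProd α (S.star₁ β) := by
  rw [← scalarProd_star₁_star₁ (S.star₁ α), star₁_star₁]
  exact (scalarProdLeft (S.star₁ β)).map_neg α

/-- The coboundary of functions is minus the adjoint of `d *`. -/
lemma scalarProd_d₀_left (f : S.Vertex → ℂ) (β : S.OneForm) :
    S.scalarProd (S.d₀ f) β = -∑ v, f v * starRingEnd ℂ (S.d₁ (S.star₁ β) v) := by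
  classical
  have e1 : ∀ v, starRingEnd ℂ (S.d₁ (S.star₁ β) v) =
      ∑ d : D with S.src d = v, (S.rho d : ℂ) * starRingEnd ℂ (β.1 d) := by
    intro v
    simp [d₁_apply, rho_face_face, OneForm.apply_face_face]
  simp only [e1]
  rw [S.sum_vertex_mul]
  have e2 : ∑ d, (S.rho d : ℂ) * f (S.src (S.face (S.face d))) * starRingEnd ℂ (β.1 d) =
      -∑ d, f (S.src d) * ((S.rho d : ℂ) * starRingEnd ℂ (β.1 d)) := by
    rw [← S.sum_comp_face, ← S.sum_comp_face, ← Finset.sum_neg_distrib]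
    refine Finset.sum_congr rfl fun d _ => ?_
    simp only [S.face_four, rho_face_face, OneForm.apply_face_face, map_neg]
    ring
  have e3 : ∑ d, (S.rho d : ℂ) * (S.d₀ f).1 d * starRingEnd ℂ (β.1 d) =
      ∑ d, (S.rho d : ℂ) * f (S.src (S.face (S.face d))) * starRingEnd ℂ (β.1 d) -
        ∑ d, f (S.src d) * ((S.rho d : ℂ) * starRingEnd ℂ (β.1 d)) := by
    rw [← Finset.sum_sub_distrib]
    refine Finset.sum_congr rfl fun d _ => ?_
    rw [d₀_apply]
    ring
  rw [scalarProd, e3, e2]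
  ring

/-! ### Harmonic forms -/

lemma sum_mul_conj_eq_zero {ι : Type*} [Fintype ι] {u : ι → ℂ}
    (h : (∑ v, u v * starRingEnd ℂ (u v)).re = 0) : u = 0 := by
  simp only [Complex.mul_conj, Complex.re_sum, Complex.ofReal_re] at h
  rw [Finset.sum_eq_zero_iff_of_nonneg fun v _ => Complex.normSq_nonneg _] at h
  funext v
  simpa using h v (Finset.mem_univ v)

lemma sum_mul_conj_re_nonneg {ι : Type*} [Fintype ι] (u : ι → ℂ) :
    0 ≤ (∑ v, u v * starRingEnd ℂ (u v)).re := by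
  simp only [Complex.mul_conj, Complex.re_sum, Complex.ofReal_re]
  exact Finset.sum_nonneg fun v _ => Complex.normSq_nonneg _

/-- `(Δα, α)` is the sum of the squared norms of `d*α` and `dα`, so both vanish when `Δα = 0`. -/
lemma mem_harmonicForms {α : S.OneForm} :
    α ∈ S.harmonicForms ↔ S.d₁ α = 0 ∧ S.d₁ (S.star₁ α) = 0 := by
  have hL : S.laplacian α = -S.d₀ (S.d₁ (S.star₁ α)) - S.star₁ (S.d₀ (S.d₁ α)) := rfl
  rw [harmonicForms, LinearMap.mem_ker]
  constructor
  · intro h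
    have h1 : S.scalarProd (S.laplacian α) α = 0 := by
      rw [h]
      simpa using scalarProd_smul_left 0 α α
    have h2 : S.scalarProd (S.laplacian α) α =
        ∑ v, S.d₁ (S.star₁ α) v * starRingEnd ℂ (S.d₁ (S.star₁ α) v) +
          ∑ v, S.d₁ α v * starRingEnd ℂ (S.d₁ α v) := by
      rw [hL, ← scalarProdLeft_apply, map_sub, map_neg]
      simp only [scalarProdLeft_apply]
      rw [scalarProd_d₀_left, scalarProd_star₁_left, scalarProd_d₀_left, star₁_star₁, map_neg]
      simp only [Pi.neg_apply, map_neg, mul_neg, Finset.sum_neg_distrib]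
      ring
    rw [h1] at h2
    have h3 := congrArg Complex.re h2
    rw [Complex.zero_re, Complex.add_re] at h3
    have p1 := sum_mul_conj_re_nonneg (S.d₁ (S.star₁ α))
    have p2 := sum_mul_conj_re_nonneg (S.d₁ α)
    exact ⟨sum_mul_conj_eq_zero (by linarith), sum_mul_conj_eq_zero (by linarith)⟩
  · rintro ⟨h1, h2⟩
    rw [hL, h1, h2]
    simp

lemma star₁_mem_harmonicForms {α : S.OneForm} (h : α ∈ S.harmonicForms) :
    S.star₁ α ∈ S.harmonicForms := by
  rw [mem_harmonicForms] at h ⊢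
  refine ⟨h.2, ?_⟩
  rw [star₁_star₁, map_neg, h.1, neg_zero]

lemma scalarProd_d₀_left_eq_zero {α : S.OneForm} (h : S.d₁ (S.star₁ α) = 0) (f : S.Vertex → ℂ) :
    S.scalarProd (S.d₀ f) α = 0 := by
  simp [scalarProd_d₀_left, h]

lemma eq_zero_of_harmonic_of_exact {α : S.OneForm} (h : α ∈ S.harmonicForms)
    (he : α ∈ LinearMap.range S.d₀) : α = 0 := by
  obtain ⟨f, rfl⟩ := he
  exact eq_zero_of_scalarProd_self (scalarProd_d₀_left_eq_zero (mem_harmonicForms.1 h).2 f)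

/-- The boundary of `v*` is a closed polygon: each dual diagonal ends where the next one in rotation
order starts, so `rot` matches the two sums. -/
lemma d₁_d₀ (f : S.Vertex → ℂ) : S.d₁ (S.d₀ f) = 0 := by
  classical
  funext v
  rw [d₁_apply]
  simp only [d₀_apply, Finset.sum_sub_distrib, Pi.zero_apply, sub_eq_zero]
  refine Finset.sum_equiv S.rot (fun d => by simp [src_rot]) fun d _ => ?_
  rw [← S.src_flip (S.rot d)]
  simp [rot, Equiv.Perm.inv_def, face_symm_apply, S.flip_flip]

/-- Hodge decomposition: a form differs from a coclosed one by an exact form. -/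
lemma exists_coclosed (θ : S.OneForm) : ∃ f, S.d₁ (S.star₁ (θ - S.d₀ f)) = 0 := by
  classical
  let T : S.OneForm →ₗ[ℂ] (S.Vertex → ℂ) := S.d₁ ∘ₗ S.star₁
  suffices h : T θ ∈ LinearMap.range (T ∘ₗ S.d₀) by
    obtain ⟨f, hf⟩ := h
    refine ⟨f, ?_⟩
    change T (θ - S.d₀ f) = 0
    rw [map_sub, ← hf]
    simp
  -- Otherwise some functional kills the range of `T ∘ d₀` but not `T θ`. Expressed through the
  -- scalar product with `d₀ u`, it forces `d₀ u` to have norm zero, hence vanishes on the whole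
  -- range of `T`.
  by_contra hn
  obtain ⟨φ, hφ, hle⟩ := Submodule.exists_le_ker_of_notMem hn
  let u : S.Vertex → ℂ := fun v => starRingEnd ℂ (φ (Pi.single v 1))
  have hu : ∀ β : S.OneForm, φ (T β) = -starRingEnd ℂ (S.scalarProd (S.d₀ u) β) := by
    intro β
    rw [scalarProd_d₀_left, map_neg, neg_neg, map_sum, LinearMap.pi_apply_eq_sum_univ φ (T β)]
    have hs : ∀ v : S.Vertex, (fun w => if v = w then (1 : ℂ) else 0) = Pi.single v 1 := by
      intro v
      funext w
      simp [Pi.single_apply, eq_comm]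
    refine Finset.sum_congr rfl fun v _ => ?_
    simp only [map_mul, Complex.conj_conj, u, smul_eq_mul, hs]
    rw [mul_comm]
    rfl
  have h0 : S.d₀ u = 0 := by
    apply eq_zero_of_scalarProd_self
    have h := hu (S.d₀ u)
    have : φ (T (S.d₀ u)) = 0 := hle ⟨u, rfl⟩
    rw [this] at h
    rw [← Complex.conj_conj (S.scalarProd (S.d₀ u) (S.d₀ u))]
    simpa using h.symm
  apply hφ
  rw [hu, h0]
  have : S.scalarProd 0 θ = 0 := (scalarProdLeft θ).map_zero
  simp [this]

end Sums

section Integrals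

variable {S}

variable (S) in
/-- The form `A ↦ A · c`, closed when `c` is a cycle. -/
noncomputable def interForm (c : D → ℤ) : S.OneForm :=
  ⟨fun d => (c (S.face d) : ℂ) - c (S.face.symm d), by
    intro d
    simp [face_symm_apply]⟩

@[simp] lemma interForm_apply (c : D → ℤ) (d : D) :
    (S.interForm c).1 d = (c (S.face d) : ℂ) - c (S.face.symm d) := rfl

/-- The complex conjugate of a form. -/
noncomputable def conjForm (α : S.OneForm) : S.OneForm :=
  ⟨fun d => starRingEnd ℂ (α.1 d), by
    intro d
    simp [OneForm.apply_face_face]⟩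

@[simp] lemma conjForm_apply (α : S.OneForm) (d : D) :
    (conjForm α).1 d = starRingEnd ℂ (α.1 d) := rfl

variable [Fintype D]

/-! ### Integrals along chains -/

/-- The integral along a chain as a linear function of the form. -/
noncomputable def integralₗ (c : D → ℤ) : S.OneForm →ₗ[ℂ] ℂ where
  toFun α := S.integral c α
  map_add' α β := by simp [integral, mul_add, Finset.sum_add_distrib]
  map_smul' r α := by
    simp only [integral, Submodule.coe_smul, Pi.smul_apply, smul_eq_mul, RingHom.id_apply,
      Finset.mul_sum]
    exact Finset.sum_congr rfl fun d _ => by ring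

@[simp] lemma integralₗ_apply (c : D → ℤ) (α : S.OneForm) :
    integralₗ c α = S.integral c α := rfl

open Classical in
lemma mem_doubleCycles {c : D → ℤ} : c ∈ S.doubleCycles ↔
    ∑ d, c d • (Pi.single (S.src (S.face (S.face d))) 1 - Pi.single (S.src d) 1 : S.Vertex → ℤ)
      = 0 := by
  rw [doubleCycles, LinearMap.mem_ker, Fintype.linearCombination_apply]

lemma integral_d₀ {c : D → ℤ} (hc : c ∈ S.doubleCycles) (f : S.Vertex → ℂ) :
    S.integral c (S.d₀ f) = 0 := by
  classical
  rw [mem_doubleCycles] at hc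
  have h := congrArg (fun u : S.Vertex → ℤ => ∑ v, (u v : ℂ) * f v) hc
  simp only [Finset.sum_apply, Pi.smul_apply, Pi.sub_apply, smul_eq_mul, Int.cast_sum,
    Int.cast_mul, Int.cast_sub, Finset.sum_mul, Pi.zero_apply, Int.cast_zero, zero_mul,
    Finset.sum_const_zero] at h
  rw [Finset.sum_comm] at h
  rw [← h, integral]
  refine Finset.sum_congr rfl fun d _ => ?_
  simp only [d₀_apply, mul_assoc, ← Finset.mul_sum, sub_mul, Finset.sum_sub_distrib]
  congr 2
  · rw [Finset.sum_eq_single (S.src (S.face (S.face d)))] <;> simp +contextual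
  · rw [Finset.sum_eq_single (S.src d)] <;> simp +contextual

/-- A form with vanishing integrals along all cycles is exact. -/
lemma exact_of_integral_eq_zero {α : S.OneForm}
    (h : ∀ c ∈ S.doubleCycles, S.integral c α = 0) : α ∈ LinearMap.range S.d₀ := by
  classical
  -- Over `ℚ` linear functionals extend, while clearing denominators still reduces every rational
  -- cycle to an integral one, where the hypothesis applies.
  let bd : (D → ℚ) →ₗ[ℚ] (S.Vertex → ℚ) := Fintype.linearCombination ℚ fun d =>
    Pi.single (S.src (S.face (S.face d))) 1 - Pi.single (S.src d) 1
  let A : (D → ℚ) →ₗ[ℚ] ℂ := Fintype.linearCombination ℚ α.1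
  have hker : LinearMap.ker bd ≤ LinearMap.ker A := by
    intro q hq
    obtain ⟨⟨n, hn⟩, hn'⟩ := IsLocalization.exist_integer_multiples_of_finite (nonZeroDivisors ℤ) q
    choose c hc using hn'
    have hn0 : (n : ℚ) ≠ 0 := by exact_mod_cast nonZeroDivisors.ne_zero hn
    have hc' : ∀ d, (c d : ℚ) = n * q d := by
      intro d
      simpa using hc d
    have hcyc : c ∈ S.doubleCycles := by
      rw [mem_doubleCycles]
      funext v
      have hq' := congrFun (LinearMap.mem_ker.1 hq) v
      simp only [bd, Fintype.linearCombination_apply, Finset.sum_apply, Pi.smul_apply,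
        Pi.sub_apply, smul_eq_mul, Pi.zero_apply] at hq' ⊢
      have : ((∑ d, c d * ((Pi.single (S.src (S.face (S.face d))) 1 : S.Vertex → ℤ) v -
          (Pi.single (S.src d) 1 : S.Vertex → ℤ) v) : ℤ) : ℚ) = 0 := by
        push_cast
        simp only [hc', mul_assoc, ← Finset.mul_sum]
        convert mul_zero (n : ℚ)
        convert hq' using 4 <;> simp [Pi.single_apply]
      exact_mod_cast this
    have hint := h c hcyc
    rw [LinearMap.mem_ker]
    have : (n : ℂ) * A q = 0 := by
      rw [← hint, integral]
      simp only [A, Fintype.linearCombination_apply, Finset.mul_sum]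
      refine Finset.sum_congr rfl fun d _ => ?_
      have : (c d : ℂ) = (n : ℂ) * (q d : ℂ) := by exact_mod_cast congrArg (Rat.cast (K := ℂ)) (hc' d)
      rw [this, Rat.smul_def, mul_assoc]
    rcases mul_eq_zero.1 this with h0 | h0
    · exact absurd h0 (by exact_mod_cast nonZeroDivisors.ne_zero hn)
    · exact h0
  -- Integration factors through the boundary map; an extension to all `0`-chains, evaluated at
  -- single vertices, is a primitive.
  obtain ⟨f, hf⟩ := LinearMap.exists_extend
    ((LinearMap.ker bd).liftQ A hker ∘ₗ bd.quotKerEquivRange.symm.toLinearMap)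
  have hf' : ∀ q, f (bd q) = A q := by
    intro q
    have := LinearMap.congr_fun hf ⟨bd q, q, rfl⟩
    simp only [LinearMap.comp_apply, Submodule.subtype_apply] at this
    rw [this]
    have h2 : bd.quotKerEquivRange.symm ⟨bd q, q, rfl⟩ = (LinearMap.ker bd).mkQ q := by
      rw [LinearEquiv.symm_apply_eq]
      rfl
    erw [h2]
    simp
  refine ⟨fun v => f (Pi.single v 1), ?_⟩
  ext d
  have h1 := hf' (Pi.single d 1)
  simp only [bd, A, Fintype.linearCombination_apply_single, one_smul, map_sub] at h1
  rw [d₀_apply, h1]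

lemma eq_zero_of_harmonic_of_integral {α : S.OneForm} (h : α ∈ S.harmonicForms)
    (h0 : ∀ c ∈ S.doubleCycles, S.integral c α = 0) : α = 0 :=
  eq_zero_of_harmonic_of_exact h (exact_of_integral_eq_zero h0)

/-! ### The forms attached to cycles -/

lemma integral_interForm (a c : D → ℤ) :
    S.integral a (S.interForm c) = (S.inter a c : ℂ) := by
  simp [integral, inter]

lemma inter_comm (a b : D → ℤ) : S.inter a b = -S.inter b a := by
  have e1 : ∑ d, a d * b (S.face d) = ∑ d, b d * a (S.face.symm d) := by
    rw [← Equiv.sum_comp S.face fun d => b d * a (S.face.symm d)]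
    simp [mul_comm]
  have e2 : ∑ d, b d * a (S.face d) = ∑ d, a d * b (S.face.symm d) := by
    rw [← Equiv.sum_comp S.face fun d => a d * b (S.face.symm d)]
    simp [mul_comm]
  simp only [inter, mul_sub, Finset.sum_sub_distrib, e1, e2]
  ring

/-- Chains on the same one of the two graphs have intersection number zero. -/
lemma inter_eq_zero_of_support {a b : D → ℤ} (κ : Bool) (ha : ∀ d, S.color d = κ → a d = 0)
    (hb : ∀ d, S.color d = κ → b d = 0) : S.inter a b = 0 := by
  refine Finset.sum_eq_zero fun d _ => ?_
  by_cases h : S.color d = κ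
  · rw [ha d h, zero_mul]
  · have h' : (!S.color d) = κ := by
      cases κ <;> simp_all
    rw [face_symm_apply, hb _ (by rw [S.color_face, h']),
      hb _ (by rw [S.color_face, S.color_face, S.color_face, Bool.not_not, h'])]
    simp

/-- The value on `v*` counts the edges of `c` arriving at `v` minus those leaving it, which is the
boundary of `c` at `v`. -/
lemma d₁_interForm {c : D → ℤ} (hc : c ∈ S.doubleCycles) : S.d₁ (S.interForm c) = 0 := by
  classical
  funext v
  rw [mem_doubleCycles] at hc
  have h := congrArg (Int.cast (R := ℂ)) (congrFun hc v)
  simp only [Finset.sum_apply, Pi.smul_apply, Pi.sub_apply, smul_eq_mul, Int.cast_sum,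
    Int.cast_mul, Int.cast_sub, Pi.zero_apply, Int.cast_zero, mul_sub,
    Finset.sum_sub_distrib] at h
  rw [← S.sum_comp_face (fun d => (c d : ℂ) *
    ((Pi.single (S.src (S.face (S.face d))) 1 : S.Vertex → ℤ) v : ℂ)), ← S.sum_comp_face] at h
  rw [d₁_apply]
  simp only [interForm_apply, Equiv.symm_apply_apply, Finset.sum_sub_distrib, Finset.sum_filter]
  refine Eq.trans ?_ h
  simp [S.face_four, Pi.single_apply, eq_comm]

/-- Every closed form is cohomologous to a harmonic form. -/
lemma exists_harmonic {θ : S.OneForm} (h : S.d₁ θ = 0) : ∃ f, θ - S.d₀ f ∈ S.harmonicForms := by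
  obtain ⟨f, hf⟩ := exists_coclosed θ
  exact ⟨f, mem_harmonicForms.2 ⟨by rw [map_sub, h, d₁_d₀, sub_zero], hf⟩⟩

/-- Subtracting an exact form makes `interForm c` harmonic without changing its periods. Two
solutions differ by a harmonic form without periods, which is exact and so orthogonal to itself. -/
lemma existsUnique_isEta {c : D → ℤ} (hc : c ∈ S.doubleCycles) :
    ∃! η : S.OneForm, S.IsEta c η := by
  obtain ⟨f, hf⟩ := exists_harmonic (d₁_interForm hc)
  refine ⟨_, ⟨hf, fun a ha => ?_⟩, fun η hη => ?_⟩
  · rw [← integralₗ_apply, map_sub, integralₗ_apply, integralₗ_apply, integral_d₀ ha, sub_zero,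
      integral_interForm]
  · rw [← sub_eq_zero]
    refine eq_zero_of_harmonic_of_integral (sub_mem hη.1 hf) fun a ha => ?_
    rw [← integralₗ_apply, map_sub, map_sub]
    simp only [integralₗ_apply]
    rw [integral_d₀ ha, integral_interForm, hη.2 a ha, sub_zero, sub_self]

lemma isEta_eta {c : D → ℤ} (hc : c ∈ S.doubleCycles) : S.IsEta c (S.eta c) :=
  Classical.epsilon_spec (existsUnique_isEta hc).exists

lemma scalarProd_interForm (μ : S.OneForm) (c : D → ℤ) :
    S.scalarProd μ (S.interForm c) = S.integral c (S.star₁ μ) := by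
  have e1 : ∑ d, (S.rho d : ℂ) * μ.1 d * (c (S.face d) : ℂ) =
      S.integral c (S.star₁ μ) := by
    -- Three shifts carry `face d` back to `d`; the other factors then sit at the reverse of the
    -- dual edge, which supplies the sign in `*`.
    rw [← S.sum_comp_face, ← S.sum_comp_face, ← S.sum_comp_face]
    refine Finset.sum_congr rfl fun d _ => ?_
    rw [star₁_apply, S.face_four, rho_face_face, OneForm.apply_face_face]
    ring
  have e2 : ∑ d, (S.rho d : ℂ) * μ.1 d * (c (S.face.symm d) : ℂ) =
      -S.integral c (S.star₁ μ) := by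
    rw [← S.sum_comp_face, integral, ← Finset.sum_neg_distrib]
    refine Finset.sum_congr rfl fun d _ => ?_
    rw [star₁_apply, Equiv.symm_apply_apply]
    ring
  simp only [scalarProd, interForm_apply, map_sub, map_intCast, mul_sub,
    Finset.sum_sub_distrib, e1, e2]
  ring

/-- `interForm c` and `eta c` have the same periods, so they differ by an exact form, and exact
forms are orthogonal to the coclosed `μ`. -/
lemma scalarProd_eta {μ : S.OneForm} (hμ : S.d₁ (S.star₁ μ) = 0) {c : D → ℤ}
    (hc : c ∈ S.doubleCycles) : S.scalarProd μ (S.eta c) = S.integral c (S.star₁ μ) := by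
  obtain ⟨f, hf⟩ : S.interForm c - S.eta c ∈ LinearMap.range S.d₀ := by
    refine exact_of_integral_eq_zero fun a ha => ?_
    rw [← integralₗ_apply, map_sub, integralₗ_apply, integralₗ_apply, (isEta_eta hc).2 a ha,
      integral_interForm, sub_self]
  rw [← scalarProd_interForm, ← conj_scalarProd, ← conj_scalarProd (S.interForm c)]
  congr 1
  rw [eq_comm, ← sub_eq_zero]
  simp only [← scalarProdLeft_apply]
  rw [← map_sub, ← hf, scalarProdLeft_apply, scalarProd_d₀_left_eq_zero hμ]

lemma conjForm_mem_harmonicForms {α : S.OneForm} (h : α ∈ S.harmonicForms) :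
    conjForm α ∈ S.harmonicForms := by
  classical
  have e : ∀ β : S.OneForm, S.d₁ β = 0 → S.d₁ (conjForm β) = 0 := by
    intro β hβ
    funext v
    simpa [d₁_apply] using congrArg (starRingEnd ℂ) (congrFun hβ v)
  have e' : S.star₁ (conjForm α) = conjForm (S.star₁ α) := by
    ext d
    simp
  rw [mem_harmonicForms] at h ⊢
  exact ⟨e _ h.1, e' ▸ e _ h.2⟩

/-- The periods are integers, so the conjugate form solves the same problem and uniqueness applies.
This makes the Gram matrix real. -/
lemma conj_eta {c : D → ℤ} (hc : c ∈ S.doubleCycles) (d : D) :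
    starRingEnd ℂ ((S.eta c).1 d) = (S.eta c).1 d := by
  have h : S.IsEta c (conjForm (S.eta c)) := by
    refine ⟨conjForm_mem_harmonicForms (isEta_eta hc).1, fun a ha => ?_⟩
    simpa [integral] using congrArg (starRingEnd ℂ) ((isEta_eta hc).2 a ha)
  rw [← conjForm_apply, (existsUnique_isEta hc).unique h (isEta_eta hc)]

end Integrals

/-! ### Closed forms and the homology of the surface -/

section Topology

variable {S}

/-- Summation by parts: `(k - 1) * b k` telescopes, and the remaining sum of the `b k` is zero. -/
lemma sum_range_mul_shift {b : ℕ → ℂ} {N : ℕ} (hN : b N = b 0)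
    (hb : ∑ k ∈ Finset.range N, b k = 0) :
    ∑ k ∈ Finset.range N, (k : ℂ) * b (k + 1) - ∑ k ∈ Finset.range N, (k : ℂ) * b k =
      N * b 0 := by
  have h1 := Finset.sum_range_sub (fun k => ((k : ℂ) - 1) * b k) N
  have h2 : ∑ k ∈ Finset.range N, (k : ℂ) * b (k + 1) - ∑ k ∈ Finset.range N, (k : ℂ) * b k =
      ∑ k ∈ Finset.range N, ((((k + 1 : ℕ) : ℂ) - 1) * b (k + 1) - ((k : ℂ) - 1) * b k) -
        ∑ k ∈ Finset.range N, b k := by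
    rw [← Finset.sum_sub_distrib, ← Finset.sum_sub_distrib]
    refine Finset.sum_congr rfl fun k _ => ?_
    push_cast
    ring
  rw [h2, h1, hb, hN]
  push_cast
  ring

/-- The path `(x, y) + (y, x')` that replaces the diagonal `(x, x')`. -/
def path (S : DiscreteRiemannSurface D) : (D → ℤ) →ₗ[ℤ] (D → ℤ) where
  toFun a := fun d => a d + a (S.face.symm d)
  map_add' a b := by
    funext d
    simp only [Pi.add_apply]
    ring
  map_smul' n a := by
    funext d
    simp [mul_add]

@[simp] lemma path_apply (a : D → ℤ) (d : D) : S.path a d = a d + a (S.face.symm d) := rfl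

lemma mkQ_path_eq {a c : D → ℤ} (h : S.Homologous a c) :
    S.quadBoundaries.mkQ (S.path a) = S.quadBoundaries.mkQ c :=
  (Submodule.Quotient.eq _).2 h

/-- The part of a chain on one of the two graphs. -/
def restrict (S : DiscreteRiemannSurface D) (κ : Bool) (a : D → ℤ) : D → ℤ :=
  fun d => if S.color d = κ then a d else 0

lemma restrict_add_restrict (a : D → ℤ) :
    S.restrict true a + S.restrict false a = a := by
  funext d
  cases h : S.color d <;> simp [restrict, h]

variable [Fintype D]

open Classical in
/-- A function of the darts whose sums around all vertices vanish is a difference along the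
rotation. -/
lemma exists_rot_primitive {a : D → ℂ} (ha : ∀ v, ∑ d : D with S.src d = v, a d = 0) :
    ∃ h : D → ℂ, ∀ d, h (S.rot d) - h d = a d := by
  -- `N` turns return every dart to itself, so one `N` serves vertices of all degrees.
  set N := orderOf S.rot with hNdef
  have hN : (N : ℂ) ≠ 0 := by exact_mod_cast (orderOf_pos S.rot).ne'
  have hper : ∀ d, (S.rot ^ N) d = d := by
    intro d
    rw [hNdef, pow_orderOf_eq_one, Equiv.Perm.one_apply]
  have hsucc : ∀ k d, (S.rot ^ k) (S.rot d) = (S.rot ^ (k + 1)) d := by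
    intro k d
    rw [pow_succ, Equiv.Perm.mul_apply]
  let F : D → ℂ := fun d => ∑ k ∈ Finset.range N, a ((S.rot ^ k) d)
  have hF : ∀ d, F (S.rot d) = F d := by
    intro d
    have h := Finset.sum_range_sub (fun k => a ((S.rot ^ k) d)) N
    simp only [hper, pow_zero, Equiv.Perm.one_apply, sub_self, Finset.sum_sub_distrib] at h
    simp only [F, hsucc]
    exact sub_eq_zero.1 h
  have hsum : ∀ v, ∑ d : D with S.src d = v, F d = 0 := by
    intro v
    -- Each power of `rot` permutes the darts at `v`, so each `k` contributes the vertex sum of `a`.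
    -- As `F` is constant at a vertex, it must be zero.
    rw [Finset.sum_comm]
    refine Finset.sum_eq_zero fun k _ => ?_
    rw [← ha v]
    have hsrc : ∀ d, S.src ((S.rot ^ k) d) = S.src d := by
      clear * -
      induction k with
      | zero => simp
      | succ k ih => intro d; rw [pow_succ, Equiv.Perm.mul_apply, ih, src_rot]
    exact Finset.sum_equiv (S.rot ^ k) (fun d => by simp [hsrc]) fun d _ => rfl
  have hF0 : ∀ d, F d = 0 := by
    intro d
    have h := hsum (S.src d)
    rw [Finset.sum_congr rfl fun e he => eq_of_src_eq hF (Finset.mem_filter.1 he).2,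
      Finset.sum_const, nsmul_eq_mul] at h
    rcases mul_eq_zero.1 h with h | h
    · have h' := Finset.card_eq_zero.1 (Nat.cast_eq_zero.1 h)
      exact absurd rfl (Finset.filter_eq_empty_iff.1 h' (Finset.mem_univ d))
    · exact h
  refine ⟨fun d => (N : ℂ)⁻¹ * ∑ k ∈ Finset.range N, (k : ℂ) * a ((S.rot ^ k) d), fun d => ?_⟩
  have h := sum_range_mul_shift (b := fun k => a ((S.rot ^ k) d)) (N := N) (by simp [hper]) (hF0 d)
  simp only [hsucc]
  rw [← mul_sub, h]
  simp [hN]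

/-- A closed form has integral zero along every chain, on one of the two graphs, that is
null-homologous on the surface. -/
lemma integral_eq_zero_of_path_mem {α : S.OneForm} (hα : S.d₁ α = 0) (κ : Bool) {b : D → ℤ}
    (hb : ∀ d, S.color d ≠ κ → b d = 0) (hP : S.path b ∈ S.quadBoundaries) :
    S.integral b α = 0 := by
  classical
  obtain ⟨h, hh⟩ := exists_rot_primitive (S := S) (a := fun d => α.1 (S.face d))
    fun v => congrFun hα v
  let β : D → ℂ := fun d => if S.color d = κ then -h (S.flip d) else h d
  have hne : ∀ x : Bool, (!x) = κ ↔ ¬ x = κ := by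
    intro x
    cases x <;> cases κ <;> simp
  have hflip : ∀ d, β d + β (S.flip d) = 0 := by
    intro d
    by_cases hd : S.color d = κ <;> simp [β, S.color_flip, hne, hd, S.flip_flip]
  have hface : ∀ d, S.color d = κ → β d + β (S.face d) = α.1 d := by
    intro d hd
    have := hh (S.face d)
    rw [rot_face, OneForm.apply_face_face] at this
    simp only [β, S.color_face, hne, hd, not_true, if_true, if_false]
    linear_combination -this
  have hquad : ∀ d, β d + β (S.face d) + β (S.face (S.face d)) +
      β (S.face (S.face (S.face d))) = 0 := by
    intro d
    -- The boundary of a quadrilateral is a diagonal of colour `κ` traversed once in each direction;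
    -- the corner where it starts depends on the colour of `d`.
    by_cases hd : S.color d = κ
    · have h1 := hface d hd
      have h2 := hface (S.face (S.face d)) (by simp [S.color_face, hd])
      rw [OneForm.apply_face_face] at h2
      linear_combination h1 + h2
    · have h1 := hface (S.face d) (by simp [S.color_face, hne, hd])
      have h2 := hface (S.face (S.face (S.face d))) (by simp [S.color_face, hne, hd])
      rw [OneForm.apply_face_face, S.face_four] at h2
      linear_combination h1 + h2
  have hker : S.quadBoundaries ≤ LinearMap.ker (Fintype.linearCombination ℤ β) := by
    refine Submodule.span_le.2 ?_
    rintro _ (⟨d, rfl⟩ | ⟨d, rfl⟩)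
    · simpa [Fintype.linearCombination_apply_single] using hflip d
    · simpa [Fintype.linearCombination_apply_single] using hquad d
  have h0 := LinearMap.mem_ker.1 (hker hP)
  rw [Fintype.linearCombination_apply] at h0
  simp only [path_apply, add_smul, Finset.sum_add_distrib] at h0
  rw [← S.sum_comp_face fun d => b (S.face.symm d) • β d, ← Finset.sum_add_distrib] at h0
  rw [← h0, integral]
  refine Finset.sum_congr rfl fun d _ => ?_
  by_cases hd : S.color d = κ
  · simp [← hface d hd, mul_add]
  · simp [hb d hd]

/-- Diagonals join vertices of equal colour, so the boundary at a vertex involves only the part of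
the chain of that colour. -/
lemma restrict_mem_doubleCycles {a : D → ℤ} (ha : a ∈ S.doubleCycles) (κ : Bool) :
    S.restrict κ a ∈ S.doubleCycles := by
  classical
  rw [mem_doubleCycles] at ha ⊢
  funext v
  obtain ⟨e, rfl⟩ := S.exists_src_eq v
  have hcol : ∀ d, S.color d ≠ S.color e →
      (Pi.single (S.src (S.face (S.face d))) 1 - Pi.single (S.src d) 1 : S.Vertex → ℤ)
        (S.src e) = 0 := by
    intro d hd
    have h1 : S.src e ≠ S.src d := fun h => hd (eq_of_src_eq S.color_rot h).symm
    have h2 : S.src e ≠ S.src (S.face (S.face d)) := fun h => hd <| by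
      rw [eq_of_src_eq S.color_rot h, S.color_face, S.color_face, Bool.not_not]
    simp [h1, h2]
  by_cases he : S.color e = κ
  · have h := congrFun ha (S.src e)
    rw [Finset.sum_apply] at h ⊢
    refine Eq.trans (Finset.sum_congr rfl fun d _ => ?_) h
    by_cases hd : S.color d = κ
    · simp [restrict, hd]
    · have := hcol d (by rw [he]; exact hd)
      rw [Pi.smul_apply, Pi.smul_apply]
      erw [this]
      simp
  · rw [Finset.sum_apply]
    refine Finset.sum_eq_zero fun d _ => ?_
    by_cases hd : S.color d = κ
    · have := hcol d (by rw [hd]; exact Ne.symm he)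
      rw [Pi.smul_apply]
      erw [this]
      simp
    · simp [restrict, hd]

lemma path_mem_quadCycles {a : D → ℤ} (ha : a ∈ S.doubleCycles) : S.path a ∈ S.quadCycles := by
  classical
  rw [mem_doubleCycles] at ha
  rw [quadCycles, LinearMap.mem_ker, Fintype.linearCombination_apply]
  simp only [path_apply, add_smul, Finset.sum_add_distrib]
  refine (congrArg₂ (· + ·) rfl (S.sum_comp_face _).symm).trans ?_
  rw [← Finset.sum_add_distrib, ← ha]
  refine Finset.sum_congr rfl fun d _ => ?_
  rw [Equiv.symm_apply_apply, ← smul_add, src_flip, src_flip, sub_add_sub_cancel']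

/-- A closed form without periods along cycles, on one of the two graphs, that represent
generators of the homology has no period along any cycle on this graph. -/
lemma integral_restrict_eq_zero {ι : Type*} [Fintype ι] {cyc p : ι → D → ℤ}
    (hspan : Submodule.span ℤ (Set.range fun k => S.quadBoundaries.mkQ (cyc k)) =
      S.quadCycles.map S.quadBoundaries.mkQ)
    (hp : ∀ k, S.Homologous (p k) (cyc k)) (κ : Bool) (hκ : ∀ k d, S.color d ≠ κ → p k d = 0)
    {α : S.OneForm} (hα : S.d₁ α = 0) (h0 : ∀ k, S.integral (p k) α = 0)
    {a : D → ℤ} (ha : a ∈ S.doubleCycles) : S.integral (S.restrict κ a) α = 0 := by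
  have hmem : S.quadBoundaries.mkQ (S.path (S.restrict κ a)) ∈
      Submodule.span ℤ (Set.range fun k => S.quadBoundaries.mkQ (cyc k)) := by
    rw [hspan]
    exact ⟨_, path_mem_quadCycles (restrict_mem_doubleCycles ha κ), rfl⟩
  obtain ⟨n, hn⟩ := (Submodule.mem_span_range_iff_exists_fun ℤ).1 hmem
  have h : S.integral (S.restrict κ a - ∑ k, n k • p k) α = 0 := by
    refine integral_eq_zero_of_path_mem hα κ (fun d hd => ?_) ?_
    · simp [restrict, hd, hκ]
    · rw [← Submodule.ker_mkQ S.quadBoundaries, LinearMap.mem_ker, map_sub, map_sub, ← hn, map_sum,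
        map_sum]
      simp only [map_smul, mkQ_path_eq (hp _), sub_self]
  have e : ∀ c, S.integral c α = Fintype.linearCombination ℤ α.1 c := by
    intro c
    simp [integral, Fintype.linearCombination_apply]
  rw [e, map_sub, map_sum, sub_eq_zero] at h
  rw [e, h]
  exact Finset.sum_eq_zero fun k _ => by rw [map_smul, ← e, h0, smul_zero]

namespace CanonicalDissection

variable {g : ℕ} (N : S.CanonicalDissection g)

/-- A cycle splits into its parts on `Γ` and `Γ*`, and the `4g` cycles include representatives of
all `2g` generators on each graph. -/
lemma integral_eq_zero {α : S.OneForm} (hα : S.d₁ α = 0)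
    (h0 : ∀ k, S.integral (N.cycΛ k) α = 0) {a : D → ℤ} (ha : a ∈ S.doubleCycles) :
    S.integral a α = 0 := by
  have h1 := integral_restrict_eq_zero N.span_eq N.primal_homologous true
    (fun k d hd => N.primal_support k d (by simpa using hd)) hα
    (by rintro (k | k); exacts [h0 (Sum.inl (Sum.inl k)), h0 (Sum.inr (Sum.inr k))]) ha
  have h2 := integral_restrict_eq_zero N.span_eq N.dual_homologous false
    (fun k d hd => N.dual_support k d (by simpa using hd)) hα
    (by rintro (k | k); exacts [h0 (Sum.inl (Sum.inr k)), h0 (Sum.inr (Sum.inl k))]) ha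
  rw [← restrict_add_restrict (S := S) a]
  simp only [integral, Pi.add_apply, Int.cast_add, add_mul, Finset.sum_add_distrib] at h1 h2 ⊢
  rw [h1, h2, add_zero]

end CanonicalDissection

end Topology

/-! ### Dual families and holomorphic forms -/

variable {S} [Fintype D]

lemma linearIndependent_of_dual {K M ι : Type*} [Field K] [AddCommGroup M] [Module K M]
    [Fintype ι] [DecidableEq ι] {v : ι → M} {p : ι → M →ₗ[K] K}
    (h : ∀ k l, p k (v l) = if k = l then 1 else 0) : LinearIndependent K v := by
  rw [Fintype.linearIndependent_iff]
  intro c hc k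
  simpa [h] using congrArg (p k) hc

lemma mem_holomorphicForms {ω : S.OneForm} :
    ω ∈ S.holomorphicForms ↔ S.d₁ ω = 0 ∧ S.star₁ ω = -(Complex.I • ω) := by
  simp [holomorphicForms, LinearMap.mem_ker, eq_neg_iff_add_eq_zero]

lemma holomorphicForms_le_harmonicForms : S.holomorphicForms ≤ S.harmonicForms := by
  intro ω hω
  rw [mem_holomorphicForms] at hω
  rw [mem_harmonicForms, hω.2]
  simp [hω.1]

/-- Since `** = -1`, the operator `i - *` is, up to the factor `2i`, the projection onto the
eigenspace of `*` for `-i`. -/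
lemma sub_star₁_mem_holomorphicForms {β : S.OneForm} (hβ : β ∈ S.harmonicForms) :
    Complex.I • β - S.star₁ β ∈ S.holomorphicForms := by
  rw [mem_harmonicForms] at hβ
  rw [mem_holomorphicForms]
  refine ⟨by simp [hβ.1, hβ.2], ?_⟩
  rw [map_sub, star₁_star₁, map_smul, smul_sub, smul_smul, Complex.I_mul_I]
  module

namespace CanonicalDissection

variable {g : ℕ} (N : S.CanonicalDissection g)

/-! ### The basis of the harmonic forms -/

lemma cycΛ_mem (k) : N.cycΛ k ∈ S.doubleCycles := by
  rcases k with (k | k) | (k | k)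
  exacts [N.primal_mem _, N.dual_mem _, N.dual_mem _, N.primal_mem _]

lemma inter_primal (k l) : S.inter (N.primal k) (N.primal l) = 0 :=
  inter_eq_zero_of_support false (N.primal_support k) (N.primal_support l)

lemma inter_dual (k l) : S.inter (N.dual k) (N.dual l) = 0 :=
  inter_eq_zero_of_support true (N.dual_support k) (N.dual_support l)

/-- Each cycle and its partner lie on opposite graphs. For pairs from `Γ*` to `Γ`, the sign from
antisymmetry cancels the one from the lower block `-I`. -/
lemma inter_cycΛ (k l) : S.inter (N.cycΛ k) (N.cycΛ l) =
    (Matrix.fromBlocks 0 1 (-1) 0 : Matrix ((Fin g ⊕ Fin g) ⊕ (Fin g ⊕ Fin g)) _ ℤ) k l := by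
  rcases k with (k | k) | (k | k) <;> rcases l with (l | l) | (l | l) <;>
    simp [cycΛ, inter_primal, inter_dual, N.inter_eq, inter_comm (N.dual _) (N.primal _),
      Matrix.one_apply, eq_comm]

lemma α_mem (k) : N.α k ∈ S.harmonicForms := by
  rcases k with k | k
  · exact (isEta_eta (N.cycΛ_mem _)).1
  · exact neg_mem (isEta_eta (N.cycΛ_mem _)).1

lemma integral_α (k l) : S.integral (N.cycΛ k) (N.α l) = if k = l then 1 else 0 := by
  rcases l with l | l
  · rw [α, Sum.elim_inl, (isEta_eta (N.cycΛ_mem _)).2 _ (N.cycΛ_mem _), inter_cycΛ]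
    rcases k with k | k <;> simp [Matrix.one_apply]
  · rw [α, Sum.elim_inr, ← integralₗ_apply, map_neg, integralₗ_apply,
      (isEta_eta (N.cycΛ_mem _)).2 _ (N.cycΛ_mem _), inter_cycΛ]
    rcases k with k | k <;> simp [Matrix.one_apply]

lemma linearIndependent_α : LinearIndependent ℂ N.α :=
  linearIndependent_of_dual (p := fun k => integralₗ (N.cycΛ k)) N.integral_α

lemma eq_sum_α {ω : S.OneForm} (hω : ω ∈ S.harmonicForms) :
    ω = ∑ k, S.integral (N.cycΛ k) ω • N.α k := by
  have hs : ∑ k, S.integral (N.cycΛ k) ω • N.α k ∈ S.harmonicForms :=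
    sum_mem fun k _ => Submodule.smul_mem _ _ (N.α_mem k)
  have hd := sub_mem hω hs
  rw [← sub_eq_zero]
  refine eq_zero_of_harmonic_of_integral hd fun a ha =>
    N.integral_eq_zero (mem_harmonicForms.1 hd).1 (fun k => ?_) ha
  rw [← integralₗ_apply, map_sub, map_sum]
  simp [N.integral_α]

lemma span_α : Submodule.span ℂ (Set.range N.α) = S.harmonicForms := by
  refine le_antisymm (Submodule.span_le.2 ?_) fun ω hω => ?_
  · rintro _ ⟨k, rfl⟩
    exact N.α_mem k
  · rw [N.eq_sum_α hω]
    exact sum_mem fun k _ => Submodule.smul_mem _ _ (Submodule.subset_span ⟨k, rfl⟩)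

/-! ### The matrix of inner products -/

lemma scalarProd_α_inl {μ : S.OneForm} (hμ : μ ∈ S.harmonicForms) (l) :
    S.scalarProd μ (N.α (Sum.inl l)) = S.integral (N.cycΛ (Sum.inr l)) (S.star₁ μ) :=
  scalarProd_eta (mem_harmonicForms.1 hμ).2 (N.cycΛ_mem _)

lemma scalarProd_α_inr {μ : S.OneForm} (hμ : μ ∈ S.harmonicForms) (l) :
    S.scalarProd μ (N.α (Sum.inr l)) = -S.integral (N.cycΛ (Sum.inl l)) (S.star₁ μ) := by
  rw [← scalarProd_eta (mem_harmonicForms.1 hμ).2 (N.cycΛ_mem _)]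
  simp [scalarProd, α]

lemma conj_α (k) (d : D) : starRingEnd ℂ ((N.α k).1 d) = (N.α k).1 d := by
  rcases k with k | k
  · exact conj_eta (N.cycΛ_mem _) d
  · simp [α, conj_eta (N.cycΛ_mem _)]

lemma conj_gram (k l) : starRingEnd ℂ (N.gram k l) = N.gram k l := by
  simp [gram, scalarProd, conj_α, Complex.conj_ofNat]

lemma gram_comm (k l) : N.gram k l = N.gram l k := by
  rw [← conj_gram, gram, Matrix.of_apply, conj_scalarProd, Matrix.of_apply]

lemma B_apply (k l) : N.B k l =
    S.integral (N.cycΛ (Sum.inr l)) (S.star₁ (N.α (Sum.inr k))) :=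
  N.scalarProd_α_inl (N.α_mem _) l

lemma C_apply (k l) : N.C k l =
    -S.integral (N.cycΛ (Sum.inl l)) (S.star₁ (N.α (Sum.inr k))) :=
  N.scalarProd_α_inr (N.α_mem _) l

/-- The relation `** = -1` in the basis `α`. -/
lemma C_mul_B_transpose : N.C * N.B.transpose = N.B * N.C := by
  ext k m
  -- `*` is applied to the expansion of `*α_{k+2g}`. The left side becomes a period of `-α_{k+2g}`
  -- along one of the first `2g` cycles, which is zero.
  have h := congrArg (fun ω => S.integral (N.cycΛ (Sum.inl m)) (S.star₁ ω))
    (N.eq_sum_α (star₁_mem_harmonicForms (N.α_mem (Sum.inr k))))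
  simp only [star₁_star₁, map_sum, map_smul] at h
  rw [← integralₗ_apply, ← integralₗ_apply, map_sum, map_neg, integralₗ_apply, integral_α,
    Fintype.sum_sum_type] at h
  simp only [map_smul, integralₗ_apply, smul_eq_mul, ← B_apply, reduceCtorEq, if_false,
    neg_zero] at h
  have e1 : ∀ l, S.integral (N.cycΛ (Sum.inl l)) (S.star₁ (N.α (Sum.inr k))) = -N.C k l := by
    intro l
    rw [C_apply, neg_neg]
  have e2 : ∀ l, S.integral (N.cycΛ (Sum.inl m)) (S.star₁ (N.α (Sum.inr l))) = -N.C l m := by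
    intro l
    rw [C_apply, neg_neg]
  have e3 : ∀ l, S.integral (N.cycΛ (Sum.inl m)) (S.star₁ (N.α (Sum.inl l))) = -N.B m l := by
    intro l
    rw [← neg_eq_iff_eq_neg, ← N.scalarProd_α_inr (N.α_mem _)]
    exact N.gram_comm (Sum.inl l) (Sum.inr m)
  simp only [e1, e2, e3, neg_mul, mul_neg, neg_neg, Finset.sum_neg_distrib] at h
  simp only [Matrix.mul_apply, Matrix.transpose_apply]
  linear_combination -h

/-- The real matrix `C`. -/
noncomputable def realC : Matrix (Fin g ⊕ Fin g) (Fin g ⊕ Fin g) ℝ := N.C.map Complex.re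

/-- The real matrix `B`. -/
noncomputable def realB : Matrix (Fin g ⊕ Fin g) (Fin g ⊕ Fin g) ℝ := N.B.map Complex.re

lemma realC_map : N.realC.map Complex.ofRealHom = N.C := by
  ext k l
  exact Complex.conj_eq_iff_re.1 (N.conj_gram _ _)

lemma realB_map : N.realB.map Complex.ofRealHom = N.B := by
  ext k l
  exact Complex.conj_eq_iff_re.1 (N.conj_gram _ _)

/-- The quadratic form at `x` is the squared norm of `∑ x_k α_{k+2g}`, a form with periods `x_k` and
so nonzero for `x ≠ 0`. -/
lemma realC_posDef : N.realC.PosDef := by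
  refine Matrix.PosDef.of_dotProduct_mulVec_pos ?_ fun x hx => ?_
  · ext k l
    exact congrArg Complex.re (N.gram_comm (Sum.inr l) (Sum.inr k))
  · let ω : S.OneForm := ∑ k, (x k : ℂ) • N.α (Sum.inr k)
    have hp : ∀ k, S.integral (N.cycΛ (Sum.inr k)) ω = x k := by
      intro k
      rw [← integralₗ_apply, map_sum]
      simp [integral_α]
    have hω : ω ≠ 0 := by
      intro h
      refine hx (funext fun k => ?_)
      have := hp k
      rw [h, ← integralₗ_apply, map_zero] at this
      exact_mod_cast this.symm
    have hC : ∀ k, S.scalarProd (N.α (Sum.inr k)) ω = ∑ l, (x l : ℂ) * N.C k l := by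
      intro k
      rw [← conj_scalarProd, ← scalarProdLeft_apply, map_sum, map_sum]
      refine Finset.sum_congr rfl fun l _ => ?_
      rw [map_smul, smul_eq_mul, map_mul, Complex.conj_ofReal, scalarProdLeft_apply, conj_scalarProd]
      rfl
    have h2 : S.scalarProd ω ω = ((star x ⬝ᵥ N.realC.mulVec x : ℝ) : ℂ) := by
      rw [← scalarProdLeft_apply, map_sum]
      simp only [map_smul, scalarProdLeft_apply, hC, ← realC_map]
      simp [dotProduct, Matrix.mulVec, mul_comm]
    have h3 := scalarProd_self_re_pos hω
    rwa [h2, Complex.ofReal_re] at h3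

lemma isUnit_realC : IsUnit N.realC.det := N.realC_posDef.det_pos.ne'.isUnit

lemma C_mul_map_inv : N.C * (N.realC⁻¹).map Complex.ofRealHom = 1 := by
  rw [← realC_map, ← Matrix.map_mul, Matrix.mul_nonsing_inv _ N.isUnit_realC]
  simp

lemma C_inv : N.C⁻¹ = (N.realC⁻¹).map Complex.ofRealHom :=
  Matrix.inv_eq_right_inv N.C_mul_map_inv

lemma isUnit_C : IsUnit N.C :=
  (Matrix.isUnit_iff_isUnit_det _).2 (Matrix.isUnit_det_of_right_inverse N.C_mul_map_inv)

lemma isUnit_det_C : IsUnit N.C.det := (Matrix.isUnit_iff_isUnit_det _).1 N.isUnit_C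

lemma C_transpose : N.C.transpose = N.C := by
  ext k l
  exact N.gram_comm _ _

/-! ### The period matrix -/

lemma periodMatrix_eq : N.periodMatrix = Complex.I • N.C⁻¹ - N.C⁻¹ * N.B := by
  rw [periodMatrix, mul_sub, Matrix.mul_smul, mul_one]

/-- Multiplying `C Bᵀ = B C` by `C⁻¹` on both sides shows that `C⁻¹ B` is symmetric. -/
lemma periodMatrix_isSymm : N.periodMatrix.IsSymm := by
  have h1 : N.C⁻¹.transpose = N.C⁻¹ := by rw [Matrix.transpose_nonsing_inv, C_transpose]
  have h2 : N.B.transpose * N.C⁻¹ = N.C⁻¹ * N.B := by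
    have h := congrArg (fun M => N.C⁻¹ * M * N.C⁻¹) N.C_mul_B_transpose
    simp only [← mul_assoc, Matrix.nonsing_inv_mul _ N.isUnit_det_C, one_mul] at h
    rwa [Matrix.mul_nonsing_inv_cancel_right _ _ N.isUnit_det_C] at h
  rw [Matrix.IsSymm, periodMatrix_eq, Matrix.transpose_sub, Matrix.transpose_smul,
    Matrix.transpose_mul, h1, h2]

lemma periodMatrix_im : N.periodMatrix.map Complex.im = N.realC⁻¹ := by
  rw [periodMatrix_eq, C_inv, ← realB_map, ← Matrix.map_mul]
  ext k l
  simp [-Matrix.map_mul]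

/-! ### The basis of holomorphic forms and its periods -/

lemma ζ_mem (k) : N.ζ k ∈ S.holomorphicForms := 
  sub_star₁_mem_holomorphicForms (sum_mem fun _ _ => Submodule.smul_mem _ _ (N.α_mem _))

lemma integral_ζ (c : D → ℤ) (k) : S.integral c (N.ζ k) =
    ∑ l, N.C⁻¹ k l * (Complex.I * S.integral c (N.α (Sum.inr l)) -
      S.integral c (S.star₁ (N.α (Sum.inr l)))) := by
  simp only [ζ]
  rw [← integralₗ_apply]
  simp only [map_sub, map_smul, map_sum, integralₗ_apply, smul_eq_mul, Finset.mul_sum, mul_sub,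
    Finset.sum_sub_distrib]
  congr 1
  exact Finset.sum_congr rfl fun l _ => by ring

lemma integral_inl_ζ (k l) :
    S.integral (N.cycΛ (Sum.inl k)) (N.ζ l) = if k = l then 1 else 0 := by
  have h := congrFun (congrFun (Matrix.nonsing_inv_mul _ N.isUnit_det_C) l) k
  rw [Matrix.mul_apply, Matrix.one_apply] at h
  rw [integral_ζ]
  simp only [integral_α, reduceCtorEq, if_false, mul_zero, zero_sub, ← C_apply]
  simpa [eq_comm] using h

lemma integral_inr_ζ (k l) :
    S.integral (N.cycΛ (Sum.inr k)) (N.ζ l) = N.periodMatrix k l := by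
  -- The expansion of `ζ_l` produces the entry with indices `l, k`, so symmetry is needed here.
  rw [← N.periodMatrix_isSymm.apply, integral_ζ, periodMatrix, Matrix.mul_apply]
  refine Finset.sum_congr rfl fun m _ => ?_
  simp [integral_α, B_apply, Matrix.one_apply, eq_comm]

lemma linearIndependent_ζ : LinearIndependent ℂ N.ζ :=
  linearIndependent_of_dual (p := fun k => integralₗ (N.cycΛ (Sum.inl k))) N.integral_inl_ζ

/-- The vanishing periods put `μ` in the span of the `α_{k+2g}`. Since `*μ = -iμ`, the same periods
give its inner products with these forms, so `μ` is orthogonal to itself. -/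
lemma eq_zero_of_holomorphic {μ : S.OneForm} (hμ : μ ∈ S.holomorphicForms)
    (h0 : ∀ k, S.integral (N.cycΛ (Sum.inl k)) μ = 0) : μ = 0 := by
  have hh := holomorphicForms_le_harmonicForms hμ
  have horth : ∀ k, S.scalarProd μ (N.α (Sum.inr k)) = 0 := by
    intro k
    rw [N.scalarProd_α_inr hh, (mem_holomorphicForms.1 hμ).2, ← integralₗ_apply, map_neg, map_smul,
      integralₗ_apply, h0]
    simp
  have horth' : ∀ k, S.scalarProd (N.α (Sum.inr k)) μ = 0 := by
    intro k
    rw [← conj_scalarProd, horth, map_zero]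
  have h := congrArg (scalarProdLeft μ) (N.eq_sum_α hh)
  rw [map_sum, Fintype.sum_sum_type] at h
  simp only [h0, zero_smul, map_zero, Finset.sum_const_zero, zero_add, map_smul] at h
  simp only [scalarProdLeft_apply, horth', smul_zero, Finset.sum_const_zero] at h
  exact eq_zero_of_scalarProd_self h

lemma span_ζ : Submodule.span ℂ (Set.range N.ζ) = S.holomorphicForms := by
  refine le_antisymm (Submodule.span_le.2 ?_) fun ω hω => ?_
  · rintro _ ⟨k, rfl⟩
    exact N.ζ_mem k
  · have hs : ∑ k, S.integral (N.cycΛ (Sum.inl k)) ω • N.ζ k ∈ S.holomorphicForms :=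
      sum_mem fun k _ => Submodule.smul_mem _ _ (N.ζ_mem k)
    have h : ω - ∑ k, S.integral (N.cycΛ (Sum.inl k)) ω • N.ζ k = 0 := by
      refine N.eq_zero_of_holomorphic (sub_mem hω hs) fun k => ?_
      rw [← integralₗ_apply, map_sub, map_sum]
      simp [N.integral_inl_ζ]
    rw [sub_eq_zero.1 h]
    exact sum_mem fun k _ => Submodule.smul_mem _ _ (Submodule.subset_span ⟨k, rfl⟩)

end CanonicalDissection

end DiscreteRiemannSurface

theorem mainTheorem3 {D : Type*} [Fintype D] (S : DiscreteRiemannSurface D) (g : ℕ)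
    (N : S.CanonicalDissection g) :
    -- the harmonic forms attached to the cycles are well defined, and `α` is a basis
    (∀ k, ∃! η : S.OneForm, S.IsEta (N.cycΛ k) η) ∧
    LinearIndependent ℂ N.α ∧
    Submodule.span ℂ (Set.range N.α) = S.harmonicForms ∧
    IsUnit N.C ∧
    -- `ζ` is a basis of the space of holomorphic forms
    LinearIndependent ℂ N.ζ ∧
    Submodule.span ℂ (Set.range N.ζ) = S.holomorphicForms ∧
    -- the periods of `ζ`
    (∀ k l, S.integral (N.cycΛ (Sum.inl k)) (N.ζ l) = if k = l then 1 else 0) ∧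
    (∀ k l, S.integral (N.cycΛ (Sum.inr k)) (N.ζ l) = N.periodMatrix k l) ∧
    -- symmetry and positivity
    N.periodMatrix.IsSymm ∧
    (N.periodMatrix.map Complex.im).PosDef :=
  ⟨fun k => DiscreteRiemannSurface.existsUnique_isEta (N.cycΛ_mem k), N.linearIndependent_α,
    N.span_α, N.isUnit_C, N.linearIndependent_ζ, N.span_ζ, N.integral_inl_ζ, N.integral_inr_ζ,
    N.periodMatrix_isSymm, by rw [N.periodMatrix_im]; exact N.realC_posDef.inv⟩
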